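/- **Notation.** $\dim_{\mathrm H}$ is Hausdorff dimension and $\mathcal H^\alpha$ is $\alpha$-dimensional Hausdorff (outer) measure. For a Euclidean space $H$, $\mathcal A(H,m)$ is the set of $m$-dimensional affine planes in $H$, with the natural metric $d(W,W')=\max\{\|P_W-P_{W'}\|,|a_W-a_{W'}|\}$, where $P_W$ is the orthogonal projection onto the linear subspace parallel to $W$ and $a_W$ is the point of $W$ closest to $0$ (other usual choices are bi-Lipschitz equivalent); $\mathcal A(d,m)=\mathcal A(\mathbb R^d,m)$. For $A\subseteq\mathbb R^d$ and an integer $k\ge 0$: - $A^{k+1}\subseteq(\mathbb R^d)^{k+1}=\mathbb R^{d(k+1)}$ is the Cartesian power, and $D\subseteq A^{k+1}$ is the set of tuples that are not affinely independent. - $\mathcal P^k(A)\subseteq\mathcal A(d,k)$ is the set of affine spans of $k+1$ affinely independent points of $A$. - $\mathcal S(A)=\{(\operatorname{aff}\{x_0,\dots,x_k\},(x_0,\dots,x_k)) : (x_0,\dots,x_k)\in A^{k+1}\setminus D\}\subseteq\mathcal A(d,k)\times\mathbb R^{d(k+1)}$. - $\mathcal W^{k+1}(A)=\{W^{k+1}=W\times\cdots\times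 W : W\in\mathcal P^k(A)\}\subseteq\mathcal A(\mathbb R^{d(k+1)},k(k+1))$. For a subset $P$ of a metric space, $f:P\to[0,\infty]$ and $\alpha\ge 0$, define $$\operatorname*{ess\,sup}^{\alpha}_{x\in P} f(x)=\sup\{q\ge 0:\mathcal H^\alpha(\{x\in P:f(x)>q\})>0\}\quad(\sup\emptyset=0)$$ if $\mathcal H^\alpha(P)>0$. If $\mathcal H^\alpha(P)=0$, define it as the limit, as $\varepsilon\to0^+$, of the right-hand side with $\alpha-\varepsilon$ in place of $\alpha$. A nonempty set $B\subseteq X\times Y$ ($X,Y$ metric spaces, $\pi_X$ the projection to $X$) has the *Fubini property* if, with $\alpha=\dim_{\mathrm H}\pi_X(B)$, $$\dim_{\mathrm H}B=\dim_{\mathrm H}\pi_X(B)+\operatorname*{ess\,sup}^{\alpha}_{x\in\pi_X(B)}\dim_{\mathrm H}(\pi_X^{-1}(x)\cap B).$$ The *effective dimension* of $E\subseteq\mathbb R^d$ is $$d_E=\min\{m\in\mathbb N : \exists\,V\in\mathcal A(d,m),\ \dim_{\mathrm H}(E\setminus V)<\dim_{\mathrm H}E\}.$$ **Statement.** Let $d,k\ge0$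 be integers, $s$ a real number and $E\subseteq\mathbb R^d$ a Borel set with $\dim_{\mathrm H}E>s>k$. Then $d_E$ exists (the minimum is over a nonempty set) and $k+1\le d_E\le d$. Let $V\in\mathcal A(d,d_E)$ be any plane with $\dim_{\mathrm H}(E\setminus V)<\dim_{\mathrm H}E$, put $F=E\cap V$, and assume that 1. $\mathcal S(F)$ has the Fubini property; 2. with $\beta=\dim_{\mathrm H}\mathcal P^k(F)$, $$\operatorname*{ess\,sup}^{\beta}_{W^{k+1}\in\mathcal W^{k+1}(F)}\dim_{\mathrm H}(F^{k+1}\cap W^{k+1})\le\max\{0,\ \dim_{\mathrm H}(F^{k+1})-(k+1)(d_E-k)\}.$$ If $1\le k\le d_E-1$, then $$\dim_{\mathrm H}\mathcal P^k(E)\ \ge\ \dim_{\mathrm H}\mathcal P^k(F)\ \ge\ (k+1)\min\{s,\,d_E-k\}.$$ -/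

import Mathlib

open Set Filter Topology MeasureTheory
open scoped ENNReal

noncomputable section

namespace EffDim

/-! ### The affine Grassmannian -/

section AffineGrassmannian

variable (H : Type*) [NormedAddCommGroup H] [InnerProductSpace ℝ H] [FiniteDimensional ℝ H]

/-- Affine planes (nonempty affine subspaces), of any dimension, of a Euclidean space `H`. -/
def AffinePlane : Type _ := {W : AffineSubspace ℝ H // (W : Set H).Nonempty}

variable {H}

/-- The underlying point set of an affine plane. -/
def AffinePlane.carrier (W : AffinePlane H) : Set H := (W.1 : Set H)

/-- The dimension of an affine plane. -/
def AffinePlane.dim (W : AffinePlane H) : ℕ := Module.finrank ℝ W.1.direction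

/-- The point of `W` closest to the origin. -/
def AffinePlane.foot (W : AffinePlane H) : H :=
  haveI : Nonempty W.1 := W.2.to_subtype
  (EuclideanGeometry.orthogonalProjection W.1 (0 : H) : H)

/-- The orthogonal projection of `H` onto the linear subspace parallel to `W`. -/
def AffinePlane.proj (W : AffinePlane H) : H →L[ℝ] H := W.1.direction.starProjection

/-- An affine plane is determined by the projection onto its direction and its foot point. -/
def AffinePlane.coords (W : AffinePlane H) : (H →L[ℝ] H) × H := (W.proj, W.foot)

theorem AffinePlane.coords_injective :
    Function.Injective (AffinePlane.coords : AffinePlane H → (H →L[ℝ] H) × H) := by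
  intro W V h
  have h1 : W.1.direction.starProjection = V.1.direction.starProjection := congrArg Prod.fst h
  have h2 : W.foot = V.foot := congrArg Prod.snd h
  have hd : W.1.direction = V.1.direction := by
    have := congrArg (fun T : H →L[ℝ] H => LinearMap.range T.toLinearMap) h1
    simpa using this
  have hW : W.foot ∈ W.1 := by
    have : Nonempty W.1 := W.2.to_subtype
    exact EuclideanGeometry.orthogonalProjection_mem _
  have hV : V.foot ∈ V.1 := by
    have : Nonempty V.1 := V.2.to_subtype
    exact EuclideanGeometry.orthogonalProjection_mem _
  apply Subtype.ext
  exact AffineSubspace.ext_of_direction_eq hd ⟨W.foot, hW, h2 ▸ hV⟩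

/-- The natural metric on affine planes:
`dist W V = max ‖P_W - P_V‖ |a_W - a_V|`, where `P_W` is the orthogonal projection onto the
direction of `W` and `a_W` is the foot point of `W`. (Norms on a finite-dimensional space are
equivalent, so every other usual choice is bi-Lipschitz equivalent to this one and gives the same
Hausdorff dimensions and the same Hausdorff null sets.) -/
instance : MetricSpace (AffinePlane H) :=
  MetricSpace.induced AffinePlane.coords AffinePlane.coords_injective inferInstance

instance : MeasurableSpace (AffinePlane H) := borel _

instance : BorelSpace (AffinePlane H) := ⟨rfl⟩

end AffineGrassmannian

/-! ### Essential suprema with respect to Hausdorff measures; the Fubini property -/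

section Fubini

variable {X Y : Type*} [EMetricSpace X] [MeasurableSpace X] [BorelSpace X] [EMetricSpace Y]

/-- `sup {q ≥ 0 : ℋ^α {x ∈ P : q < f x} > 0}`, with `sup ∅ = 0`. -/
def essSupPos (α : ℝ) (P : Set X) (f : X → ℝ≥0∞) : ℝ≥0∞ :=
  sSup {q : ℝ≥0∞ | 0 < μH[α] {x ∈ P | q < f x}}

open Classical in
/-- The `α`-essential supremum of `f` over `P`: it is `essSupPos α P f` if `ℋ^α P > 0`, and
the limit of `essSupPos (α - ε) P f` as `ε → 0+` if `ℋ^α P = 0`. -/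
def hausdorffEssSup (α : ℝ) (P : Set X) (f : X → ℝ≥0∞) : ℝ≥0∞ :=
  if 0 < μH[α] P then essSupPos α P f
  else limUnder (𝓝[>] (0 : ℝ)) (fun ε => essSupPos (α - ε) P f)

theorem essSupPos_antitone {α β : ℝ} (h : α ≤ β) (P : Set X) (f : X → ℝ≥0∞) :
    essSupPos β P f ≤ essSupPos α P f :=
  sSup_le_sSup fun _ hq => lt_of_lt_of_le hq (Measure.hausdorffMeasure_mono h _)

/-- The limit in the definition of `hausdorffEssSup` always exists. -/
theorem tendsto_essSupPos (α : ℝ) (P : Set X) (f : X → ℝ≥0∞) :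
    Tendsto (fun ε => essSupPos (α - ε) P f) (𝓝[>] (0 : ℝ))
      (𝓝 (limUnder (𝓝[>] (0 : ℝ)) (fun ε => essSupPos (α - ε) P f))) := by
  have hm : Monotone (fun ε : ℝ => essSupPos (α - ε) P f) := fun a b hab =>
    essSupPos_antitone (by linarith) P f
  exact tendsto_nhds_limUnder ⟨_, hm.tendsto_nhdsGT 0⟩

/-- A nonempty set `B ⊆ X × Y` has the Fubini property if
`dim B = dim π_X(B) + ess-sup^α_x dim (π_X⁻¹(x) ∩ B)`, where `α = dim π_X(B)`. -/
def HasFubiniProperty (B : Set (X × Y)) : Prop :=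
  B.Nonempty ∧
    dimH B = dimH (Prod.fst '' B) +
      hausdorffEssSup (dimH (Prod.fst '' B)).toReal (Prod.fst '' B)
        (fun x => dimH (Prod.fst ⁻¹' {x} ∩ B))

end Fubini

/-! ### Planes spanned by points of a set -/

/-- `ℝ^d` with its Euclidean norm. -/
abbrev Euc (d : ℕ) : Type := EuclideanSpace ℝ (Fin d)

/-- `(ℝ^d)^(k+1) = ℝ^(d(k+1))` with its Euclidean norm. -/
abbrev Tuples (d k : ℕ) : Type := PiLp 2 (fun _ : Fin (k + 1) => Euc d)

variable {d : ℕ}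

/-- The power `A^(k+1) ⊆ (ℝ^d)^(k+1)`. -/
def power (k : ℕ) (A : Set (Euc d)) : Set (Tuples d k) := {x | ∀ i, x i ∈ A}

/-- The affine plane `W^(k+1) = W × ⋯ × W` of `(ℝ^d)^(k+1)`. -/
def powerPlane (k : ℕ) (W : AffinePlane (Euc d)) : AffinePlane (Tuples d k) :=
  ⟨{ carrier := power k W.carrier
     smul_vsub_vadd_mem' := by
       intro c p₁ p₂ p₃ h₁ h₂ h₃ i
       exact W.1.smul_vsub_vadd_mem c (h₁ i) (h₂ i) (h₃ i) },
    ⟨WithLp.toLp 2 fun _ => W.2.some, fun _ => W.2.some_mem⟩⟩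

/-- `ψ_k`: the affine span of a `(k+1)`-tuple of points. -/
def spanPlane {k : ℕ} (x : Tuples d k) : AffinePlane (Euc d) :=
  ⟨affineSpan ℝ (Set.range fun i => x i), (Set.range_nonempty _).affineSpan ℝ⟩

/-- The set `D` of degenerate tuples of `A^(k+1)`: those that are not affinely independent. -/
def degenerate (k : ℕ) (A : Set (Euc d)) : Set (Tuples d k) :=
  {x ∈ power k A | ¬ AffineIndependent ℝ (fun i => x i)}

/-- `𝒫^k(A)`: the affine `k`-planes spanned by `k+1` affinely independent points of `A`. -/
def spannedPlanes (k : ℕ) (A : Set (Euc d)) : Set (AffinePlane (Euc d)) :=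
  {W | ∃ x ∈ power k A, AffineIndependent ℝ (fun i => x i) ∧ W = spanPlane x}

/-- The incidence set `𝒮 = {(ψ_k(x), x) : x ∈ A^(k+1) \ D}`. -/
def incidenceSet (k : ℕ) (A : Set (Euc d)) : Set (AffinePlane (Euc d) × Tuples d k) :=
  (fun x => (spanPlane x, x)) '' (power k A \ degenerate k A)

/-- `𝒲^(k+1)(A) = {W^(k+1) : W ∈ 𝒫^k(A)}`. -/
def diagonalPlanes (k : ℕ) (A : Set (Euc d)) : Set (AffinePlane (Tuples d k)) :=
  powerPlane k '' spannedPlanes k A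

/-! ### Effective dimension -/

/-- The affine plane `V` captures `E` up to a set of smaller Hausdorff dimension. -/
def Captures (V : AffinePlane (Euc d)) (E : Set (Euc d)) : Prop :=
  dimH (E \ V.carrier) < dimH E

/-- The effective dimension of `E`: the least dimension of an affine plane capturing `E`. -/
def effectiveDim (E : Set (Euc d)) : ℕ :=
  sInf {m : ℕ | ∃ V : AffinePlane (Euc d), V.dim = m ∧ Captures V E}

end EffDim

end

open EffDim

/-!
The incidence set of `F` fibres over the set `𝒫` of spanned planes, with total space a copy of
`F ^ (k + 1)` without the degenerate tuples, and with fibre over `W` a part of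
`F ^ (k + 1) ∩ W ^ (k + 1)`. The map `W ↦ W ^ (k + 1)` is bi-Lipschitz, since on the coordinates
(projection, foot point) it is the restriction of an injective linear map. So the Fubini property
and the assumed bound on the fibres give (`dimH_power_diff_degenerate_le`)
`dim (F ^ (k + 1) \ D) ≤ dim 𝒫 + max 0 (dim F ^ (k + 1) - (k + 1) (d_E - k))`.
Two facts turn this into the lower bound for `dim 𝒫`:
* `dim F ^ (k + 1) ≥ (k + 1) dim F` (`mul_dimH_le_dimH_power`);
* the degenerate tuples are negligible (`dimH_power_diff_degenerate`). Some point of a degenerate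
  tuple is a linear combination of the other `k` points, so
  `dim D ≤ dim F ^ k + k < dim F ^ k + dim F ≤ dim F ^ (k + 1)`.

Both rest on the inequality `dim A + dim B ≤ dim (A × B)` (`dimH_add_le_dimH_prod_pi`), proved here
for arbitrary sets `A ⊆ ℝᵐ` and `B`, without Frostman measures. A cover of `A × B` by small sets
`U i` weights the dyadic cubes that meet the projections of the `U i` to `ℝᵐ`. The slices over each
`x ∈ A` cover `B`, so the total weight of the cubes around `x` is bounded below. A random threshold
rounds such a weighted cover of `A` by nested cells to a genuine cover of no greater cost
(`exists_cells_cover_of_weighted_cover`).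
-/

open EffDim


/-! ### Hausdorff null sets and covers at dyadic scales -/

/-- `A` has a countable cover by sets `U i`, each with an assigned dyadic scale `2⁻ⁿ⁽ⁱ⁾` at least
its diameter, for which the sum of the `u`-th powers of the scales is at most `ε`. Working with the
scale instead of the diameter avoids the special case of sets of diameter zero. -/
def HasScaleCover {X : Type*} [EMetricSpace X] (u : ℝ) (ε : ℝ≥0∞) (A : Set X) : Prop :=
  ∃ (ι : Type) (_ : Countable ι) (U : ι → Set X) (n : ι → ℕ), A ⊆ ⋃ i, U i ∧
    (∀ i, Metric.ediam (U i) ≤ 2⁻¹ ^ n i) ∧ ∑' i, ((2⁻¹ : ℝ≥0∞) ^ n i) ^ u ≤ ε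

theorem HasScaleCover.mono {X : Type*} [EMetricSpace X] {u : ℝ} {ε δ : ℝ≥0∞} {A : Set X}
    (h : HasScaleCover u ε A) (hεδ : ε ≤ δ) : HasScaleCover u δ A := by
  obtain ⟨ι, hι, U, n, h1, h2, h3⟩ := h
  exact ⟨ι, hι, U, n, h1, h2, h3.trans hεδ⟩

section ScaleCover

variable {X : Type*} [EMetricSpace X] [MeasurableSpace X] [BorelSpace X]

theorem hausdorffMeasure_eq_zero_of_hasScaleCover {u : ℝ} (hu : 0 < u) {A : Set X}
    (h : ∀ ε : ℝ≥0∞, 0 < ε → ε ≠ ⊤ → HasScaleCover u ε A) : μH[u] A = 0 := by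
  have h' : ∀ m : ℕ, HasScaleCover u ((2⁻¹ : ℝ≥0∞) ^ m) A := fun m =>
    h _ (ENNReal.pow_pos (by simp) m) (ENNReal.pow_ne_top (by simp))
  choose ι hι U n hcov hdiam hsum using h'
  have hpow : Tendsto (fun m : ℕ => (2⁻¹ : ℝ≥0∞) ^ m) atTop (𝓝 0) :=
    ENNReal.tendsto_pow_atTop_nhds_zero_of_lt_one (by simp)
  have hr : Tendsto (fun m : ℕ => ((2⁻¹ : ℝ≥0∞) ^ m) ^ u⁻¹) atTop (𝓝 0) := by
    have := (ENNReal.continuous_rpow_const (y := u⁻¹)).tendsto 0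
    rw [ENNReal.zero_rpow_of_pos (inv_pos.2 hu)] at this
    exact this.comp hpow
  have hle := Measure.hausdorffMeasure_le_liminf_tsum u A (l := atTop) _ hr U
    (Eventually.of_forall fun m i => by
      refine (hdiam m i).trans ((ENNReal.le_rpow_inv_iff hu).2 ?_)
      exact (ENNReal.le_tsum i).trans (hsum m))
    (Eventually.of_forall hcov)
  refine le_antisymm (hle.trans ?_) zero_le
  have : liminf (fun m => ∑' i, Metric.ediam (U m i) ^ u) atTop ≤
      liminf (fun m : ℕ => (2⁻¹ : ℝ≥0∞) ^ m) atTop :=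
    liminf_le_liminf (Eventually.of_forall fun m =>
      (ENNReal.tsum_le_tsum fun i => ENNReal.rpow_le_rpow (hdiam m i) hu.le).trans (hsum m))
  exact this.trans hpow.liminf_eq.le

/-- A dyadic scale above a given diameter can be chosen within a factor two of it, up to an
arbitrarily small additive error, which is what makes diameter zero harmless. -/
theorem exists_dyadic_scale {u : ℝ} (hu : 0 < u) {r : ℝ≥0∞} (hr : r < 1) {ε : ℝ≥0∞} (hε : 0 < ε) :
    ∃ n : ℕ, r ≤ 2⁻¹ ^ n ∧ ((2⁻¹ : ℝ≥0∞) ^ n) ^ u ≤ 2 ^ u * (r ^ u + ε) := by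
  have hcont : Tendsto (fun x : ℝ≥0∞ => x ^ u) (𝓝[>] r) (𝓝 (r ^ u)) :=
    ((ENNReal.continuous_rpow_const (y := u)).tendsto r).mono_left nhdsWithin_le_nhds
  have hfin : r ^ u ≠ ⊤ := ENNReal.rpow_ne_top_of_nonneg hu.le (hr.trans ENNReal.one_lt_top).ne
  have hev : ∀ᶠ x in 𝓝[>] r, x ^ u < r ^ u + ε :=
    hcont.eventually_lt_const (ENNReal.lt_add_right hfin hε.ne')
  have hev1 : ∀ᶠ x in 𝓝[>] r, x < 1 := nhdsWithin_le_nhds (eventually_lt_nhds hr)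
  have : (𝓝[>] r).NeBot := nhdsGT_neBot_of_exists_gt ⟨1, hr⟩
  obtain ⟨x, ⟨hx, hx1⟩, hrx⟩ := ((hev.and hev1).and self_mem_nhdsWithin).exists
  have hrx : r < x := hrx
  have hex : ∃ n : ℕ, (2⁻¹ : ℝ≥0∞) ^ n < x :=
    ((ENNReal.tendsto_pow_atTop_nhds_zero_of_lt_one (by simp)).eventually_lt_const
      (zero_le.trans_lt hrx)).exists
  classical
  have hspec := Nat.find_spec hex
  have hmin := fun m => Nat.find_min hex (m := m)
  generalize Nat.find hex = N at hspec hmin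
  rcases N with _ | N
  · simp only [pow_zero] at hspec
    exact absurd hx1 hspec.le.not_gt
  · have h1 : x ≤ 2⁻¹ ^ N := not_lt.1 (hmin N (Nat.lt_succ_self N))
    refine ⟨N, hrx.le.trans h1, ?_⟩
    have h2 : (2⁻¹ : ℝ≥0∞) ^ N ≤ 2 * x := by
      calc (2⁻¹ : ℝ≥0∞) ^ N = 2 * 2⁻¹ ^ (N + 1) := by
            rw [pow_succ, mul_comm _ (2⁻¹ : ℝ≥0∞), ← mul_assoc,
              ENNReal.mul_inv_cancel (by simp) (by simp), one_mul]
        _ ≤ 2 * x := by gcongr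
    calc ((2⁻¹ : ℝ≥0∞) ^ N) ^ u ≤ (2 * x) ^ u := ENNReal.rpow_le_rpow h2 hu.le
      _ = 2 ^ u * x ^ u := ENNReal.mul_rpow_of_nonneg _ _ hu.le
      _ ≤ _ := by gcongr

theorem hasScaleCover_of_hausdorffMeasure_eq_zero {u : ℝ} (hu : 0 < u) {A : Set X}
    (h : μH[u] A = 0) {ε : ℝ≥0∞} (hε : 0 < ε) : HasScaleCover u ε A := by
  have h2u : (2 : ℝ≥0∞) ^ u ≠ 0 := by simp [ENNReal.rpow_eq_zero_iff]
  have h2t : (2 : ℝ≥0∞) ^ u ≠ ⊤ := ENNReal.rpow_ne_top_of_nonneg hu.le (by simp)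
  set δ : ℝ≥0∞ := ε / (2 ^ u) / 2 with hδ
  have hδ0 : 0 < δ := ENNReal.half_pos (ENNReal.div_pos hε.ne' h2t).ne'
  rw [Measure.hausdorffMeasure_apply] at h
  have h1 := (iSup₂_le_iff.1 h.le) 2⁻¹ (by simp)
  have h2 := h1.trans_lt hδ0
  simp only [iInf_lt_iff] at h2
  obtain ⟨t, htA, htd, hts⟩ := h2
  obtain ⟨η, hη0, hη⟩ := ENNReal.exists_pos_sum_of_countable hδ0.ne' ℕ
  have hsc := fun i => exists_dyadic_scale hu (r := Metric.ediam (t i))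
    ((htd i).trans_lt (by simp)) (ε := η i) (by exact_mod_cast hη0 i)
  choose n hn hn' using hsc
  refine ⟨ℕ, inferInstance, t, n, htA, hn, ?_⟩
  calc ∑' i, ((2⁻¹ : ℝ≥0∞) ^ n i) ^ u ≤ ∑' i, 2 ^ u * (Metric.ediam (t i) ^ u + η i) :=
        ENNReal.tsum_le_tsum hn'
    _ = 2 ^ u * (∑' i, Metric.ediam (t i) ^ u + ∑' i, (η i : ℝ≥0∞)) := by
        rw [ENNReal.tsum_mul_left, ENNReal.tsum_add]
    _ ≤ 2 ^ u * (δ + δ) := by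
        gcongr
        refine le_trans (ENNReal.tsum_le_tsum fun i => ?_) hts.le
        rcases (t i).eq_empty_or_nonempty with he | hne
        · simp [he, ENNReal.zero_rpow_of_pos hu]
        · simp [hne]
    _ = ε := by
        rw [hδ, ENNReal.add_halves, ENNReal.mul_div_cancel h2u h2t]

end ScaleCover

/-! ### Rounding a weighted family of nested cells to a cover -/

/-- **Threshold rounding.** Let `q n x` be the generation `n` cell of `x`, for nested partitions.
If a weighted family of cells covers each point of `A` with total weight at least one, then some
unweighted family of cells covers `A` at no greater cost. For a threshold `θ ∈ (0, 1)`, select the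
cells at which the total weight of the cell and its ancestors first exceeds `θ`: the selected cells
cover `A` for every `θ`, and a cell of weight `c` is selected with probability at most `c`. -/
theorem exists_cells_cover_of_weighted_cover {X I : Type*} [Countable I] (q : ℕ → X → I)
    (hq : ∀ n x y, q (n + 1) x = q (n + 1) y → q n x = q n y) (w : ℕ → ℝ≥0∞)
    (c : ℕ × I → ℝ≥0∞) (A : Set X) (hA : ∀ x ∈ A, 1 ≤ ∑' n, c (n, q n x)) :
    ∃ T : Set (ℕ × I), (∀ x ∈ A, ∃ n, (n, q n x) ∈ T) ∧
      ∑' j : T, w j.1.1 ≤ ∑' j, c j * w j.1 := by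
  classical
  set F : ℕ → X → ℝ≥0∞ := fun n x => ∑ m ∈ Finset.range n, c (m, q m x) with hF
  have hq' : ∀ n x y, q n x = q n y → ∀ m ≤ n, q m x = q m y := by
    intro n x y h m hm
    induction hm using Nat.decreasingInduction with
    | of_succ k hk ih => exact hq k x y ih
    | self => exact h
  have hFq : ∀ n x y, q n x = q n y → F n x = F n y ∧ F (n + 1) x = F (n + 1) y := by
    intro n x y h
    constructor <;> refine Finset.sum_congr rfl fun m hm => ?_
    · rw [hq' n x y h m (Finset.mem_range.1 hm).le]
    · rw [hq' n x y h m (Nat.lt_succ_iff.1 (Finset.mem_range.1 hm))]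
  set T : ℝ → Set (ℕ × I) := fun θ => {j | ∃ x ∈ A, q j.1 x = j.2 ∧
    F j.1 x ≤ ENNReal.ofReal θ ∧ ENNReal.ofReal θ < F (j.1 + 1) x} with hT
  set S : ℕ × I → Set ℝ := fun j => {θ | j ∈ T θ} with hS
  have hSx : ∀ j, ∀ x ∈ A, q j.1 x = j.2 →
      S j = {θ | F j.1 x ≤ ENNReal.ofReal θ ∧ ENNReal.ofReal θ < F (j.1 + 1) x} := by
    intro j x hx hxj
    ext θ
    constructor
    · rintro ⟨y, -, hyj, h⟩
      have := hFq j.1 y x (hyj.trans hxj.symm)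
      rwa [this.1, this.2] at h
    · intro h
      exact ⟨x, hx, hxj, h⟩
  have hSe : ∀ j, (¬ ∃ x ∈ A, q j.1 x = j.2) → S j = ∅ := by
    intro j hj
    refine eq_empty_of_forall_notMem ?_
    rintro θ ⟨x, hx, hxj, -⟩
    exact hj ⟨x, hx, hxj⟩
  have hSmeas : ∀ j, MeasurableSet (S j) := by
    intro j
    by_cases hj : ∃ x ∈ A, q j.1 x = j.2
    · obtain ⟨x, hx, hxj⟩ := hj
      rw [hSx j x hx hxj]
      exact (measurableSet_le measurable_const ENNReal.measurable_ofReal).inter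
        (measurableSet_lt ENNReal.measurable_ofReal measurable_const)
    · rw [hSe j hj]; exact MeasurableSet.empty
  set μ : Measure ℝ := volume.restrict (Ioo 0 1) with hμ
  have hprob : IsProbabilityMeasure μ := ⟨by simp [hμ]⟩
  have hSvol : ∀ j, μ (S j) ≤ c j := by
    intro j
    by_cases hj : ∃ x ∈ A, q j.1 x = j.2
    · obtain ⟨x, hx, hxj⟩ := hj
      rw [hSx j x hx hxj]
      rcases eq_or_ne (c j) ⊤ with hc | hc
      · simp [hc]
      rcases eq_or_ne (F j.1 x) ⊤ with hf | hf
      · simp [hf]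
      have hsucc : F (j.1 + 1) x = F j.1 x + c j := by
        simp only [hF, Finset.sum_range_succ, hxj]
      rw [hμ, Measure.restrict_apply' measurableSet_Ioo]
      calc _ ≤ volume (Ico (F j.1 x).toReal ((F j.1 x).toReal + (c j).toReal)) := by
            refine measure_mono ?_
            rintro θ ⟨⟨h1, h2⟩, h3⟩
            refine ⟨ENNReal.toReal_le_of_le_ofReal h3.1.le h1, ?_⟩
            rw [hsucc, ← ENNReal.ofReal_toReal (ENNReal.add_ne_top.2 ⟨hf, hc⟩),
              ENNReal.toReal_add hf hc] at h2
            exact (ENNReal.ofReal_lt_ofReal_iff_of_nonneg h3.1.le).1 h2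
        _ = c j := by simp [ENNReal.ofReal_toReal hc]
    · rw [hSe j hj]; simp
  obtain ⟨θ, hθ, hle⟩ := exists_notMem_null_le_lintegral (μ := μ) (N := (Ioo (0 : ℝ) 1)ᶜ)
    (f := fun θ => ∑' j, (S j).indicator (fun _ => w j.1) θ)
    (Measurable.tsum fun j => measurable_const.indicator (hSmeas j)).aemeasurable
    (by rw [hμ, Measure.restrict_apply measurableSet_Ioo.compl]; simp)
  have hθ : θ ∈ Ioo (0 : ℝ) 1 := not_not.1 hθ
  refine ⟨T θ, ?_, ?_⟩
  · intro x hx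
    have h1 : ENNReal.ofReal θ < ∑' n, c (n, q n x) :=
      (by simpa using hθ.2 : ENNReal.ofReal θ < 1).trans_le (hA x hx)
    have hex : ∃ n, ENNReal.ofReal θ < F n x :=
      ((ENNReal.tendsto_nat_tsum fun n => c (n, q n x)).eventually_const_lt h1).exists
    have hspec := Nat.find_spec hex
    have hmin := fun m => Nat.find_min hex (m := m)
    generalize Nat.find hex = N at hspec hmin
    rcases N with _ | N
    · simp [hF] at hspec
    · exact ⟨N, x, hx, rfl, not_lt.1 (hmin N (Nat.lt_succ_self N)), hspec⟩
  · calc ∑' j : T θ, w j.1.1 = ∑' j, (S j).indicator (fun _ => w j.1) θ := by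
          rw [tsum_subtype (T θ) fun j => w j.1]
          rfl
      _ ≤ ∫⁻ θ, ∑' j, (S j).indicator (fun _ => w j.1) θ ∂μ := hle
      _ = ∑' j, ∫⁻ θ, (S j).indicator (fun _ => w j.1) θ ∂μ :=
          lintegral_tsum fun j => (measurable_const.indicator (hSmeas j)).aemeasurable
      _ = ∑' j, w j.1 * μ (S j) := by
          congr 1; ext j; rw [lintegral_indicator_const (hSmeas j)]
      _ ≤ ∑' j, c j * w j.1 := by
          refine ENNReal.tsum_le_tsum fun j => ?_
          rw [mul_comm]
          gcongr
          exact hSvol j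

/-- Threshold rounding for a weighted family of cells that is indexed by an arbitrary type and may
contain repetitions. -/
theorem exists_cells_cover_of_indexed_weighted_cover {X I κ : Type*} [Countable I] (q : ℕ → X → I)
    (hq : ∀ n x y, q (n + 1) x = q (n + 1) y → q n x = q n y) (w : ℕ → ℝ≥0∞)
    (n : κ → ℕ) (z : κ → I) (c : κ → ℝ≥0∞) (A : Set X)
    (hA : ∀ x ∈ A, 1 ≤ ∑' i : {i // q (n i) x = z i}, c i) :
    ∃ T : Set (ℕ × I), (∀ x ∈ A, ∃ n, (n, q n x) ∈ T) ∧
      ∑' j : T, w j.1.1 ≤ ∑' i, c i * w (n i) := by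
  classical
  obtain ⟨T, h1, h3⟩ := exists_cells_cover_of_weighted_cover q hq w
    (fun j => ∑' i, if (n i, z i) = j then c i else 0) A (fun x hx => by
      rw [ENNReal.tsum_comm]
      refine (hA x hx).trans ?_
      refine (tsum_subtype {i | q (n i) x = z i} c).le.trans ?_
      refine ENNReal.tsum_le_tsum fun i => ?_
      by_cases hi : q (n i) x = z i
      · rw [indicator_of_mem (by exact hi)]
        refine le_trans ?_ (ENNReal.le_tsum (n i))
        simp [hi]
      · rw [indicator_of_notMem (by exact hi)]
        exact zero_le)
  refine ⟨T, h1, h3.trans_eq ?_⟩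
  simp_rw [← ENNReal.tsum_mul_right]
  rw [ENNReal.tsum_comm]
  congr 1; ext i
  rw [tsum_eq_single (n i, z i)]
  · simp
  · intro j hj
    simp [hj.symm]

/-! ### Hausdorff dimension of products -/

/-- The index of the half-open dyadic cube of side `2⁻ⁿ` that contains `x`. -/
noncomputable def dyadicCell {m : ℕ} (n : ℕ) (x : Fin m → ℝ) : Fin m → ℤ := fun i => ⌊2 ^ n * x i⌋

theorem dyadicCell_nested {m : ℕ} (n : ℕ) (x y : Fin m → ℝ)
    (h : dyadicCell (n + 1) x = dyadicCell (n + 1) y) : dyadicCell n x = dyadicCell n y := by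
  have key : ∀ x : ℝ, ⌊2 ^ n * x⌋ = ⌊2 ^ (n + 1) * x⌋ / 2 := by
    intro x
    have h1 := Int.floor_le (2 ^ (n + 1) * x)
    have h2 := Int.lt_floor_add_one (2 ^ (n + 1) * x)
    set a := ⌊2 ^ (n + 1) * x⌋
    have h3 : 2 * (a / 2) ≤ a := by omega
    have h4 : a + 1 ≤ 2 * (a / 2) + 2 := by omega
    have h3' : 2 * ((a / 2 : ℤ) : ℝ) ≤ a := by exact_mod_cast h3
    have h4' : (a : ℝ) + 1 ≤ 2 * ((a / 2 : ℤ) : ℝ) + 2 := by exact_mod_cast h4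
    rw [pow_succ] at h1 h2
    rw [Int.floor_eq_iff]
    constructor <;> linarith
  funext i
  have := congrFun h i
  simp only [dyadicCell] at this ⊢
  rw [key, key, this]

theorem ediam_dyadicCell_le {m : ℕ} (n : ℕ) (z : Fin m → ℤ) :
    Metric.ediam {x : Fin m → ℝ | dyadicCell n x = z} ≤ 2⁻¹ ^ n := by
  have h2 : (2⁻¹ : ℝ≥0∞) ^ n = ENNReal.ofReal (2⁻¹ ^ n) := by
    rw [ENNReal.ofReal_pow (by norm_num), ENNReal.ofReal_inv_of_pos (by norm_num)]; simp
  refine Metric.ediam_le fun x hx y hy => ?_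
  rw [edist_dist, h2]
  refine ENNReal.ofReal_le_ofReal ((dist_pi_le_iff (by positivity)).2 fun i => ?_)
  have h3 : ⌊2 ^ n * x i⌋ = ⌊2 ^ n * y i⌋ := congrFun (hx.trans hy.symm) i
  have h4 := Int.abs_sub_lt_one_of_floor_eq_floor h3
  rw [← mul_sub, abs_mul, abs_of_pos (by positivity)] at h4
  rw [Real.dist_eq, inv_pow, ← one_div, le_div_iff₀' (by positivity)]
  exact h4.le

/-- Points at distance at most `2⁻ⁿ` lie in equal or adjacent dyadic cubes of side `2⁻ⁿ`. -/
theorem exists_dyadicCell_eq_add {m : ℕ} (n : ℕ) (x y : Fin m → ℝ) (h : edist x y ≤ 2⁻¹ ^ n) :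
    ∃ e : Fin m → Fin 3, dyadicCell n x = fun i => dyadicCell n y i + ((e i : ℕ) : ℤ) - 1 := by
  have h2 : (2⁻¹ : ℝ≥0∞) ^ n = ENNReal.ofReal (2⁻¹ ^ n) := by
    rw [ENNReal.ofReal_pow (by norm_num), ENNReal.ofReal_inv_of_pos (by norm_num)]; simp
  rw [edist_dist, h2, ENNReal.ofReal_le_ofReal_iff (by positivity)] at h
  have hfl : ∀ i, ∃ e : Fin 3, dyadicCell n x i = dyadicCell n y i + ((e : ℕ) : ℤ) - 1 := by
    intro i
    have hi := (dist_le_pi_dist x y i).trans h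
    rw [Real.dist_eq, inv_pow, ← one_div, le_div_iff₀' (by positivity)] at hi
    have hi' : |2 ^ n * x i - 2 ^ n * y i| ≤ 1 := by
      rwa [← mul_sub, abs_mul, abs_of_pos (a := (2 : ℝ) ^ n) (by positivity)]
    obtain ⟨ha, hb⟩ := abs_le.1 hi'
    have l1 : ⌊2 ^ n * x i⌋ ≤ ⌊2 ^ n * y i⌋ + 1 := by
      rw [← Int.floor_add_one]; exact Int.floor_mono (by linarith)
    have l2 : ⌊2 ^ n * y i⌋ ≤ ⌊2 ^ n * x i⌋ + 1 := by
      rw [← Int.floor_add_one]; exact Int.floor_mono (by linarith)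
    refine ⟨⟨(⌊2 ^ n * x i⌋ - ⌊2 ^ n * y i⌋ + 1).toNat, by omega⟩, ?_⟩
    simp only [dyadicCell]
    omega
  choose e he using hfl
  exact ⟨e, funext he⟩

theorem rpow_add_dyadic (n : ℕ) (s t : ℝ) :
    ((2⁻¹ : ℝ≥0∞) ^ n) ^ (s + t) = (2⁻¹ ^ n) ^ s * (2⁻¹ ^ n) ^ t :=
  ENNReal.rpow_add s t (ENNReal.pow_pos (by simp) n).ne' (ENNReal.pow_ne_top (by simp))

section Product

variable {Y : Type*} [EMetricSpace Y] [MeasurableSpace Y] [BorelSpace Y]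

/-- A cover of `A ×ˢ B` by sets `U i` gives weights to the dyadic cubes that meet the projection of
`U i` to the first factor: over each `x ∈ A` the slices of the `U i` cover `B`, so the total weight
at `x` is bounded below. Rounding these weights gives an efficient dyadic cover of `A`. -/
theorem hausdorffMeasure_prod_ne_zero {m : ℕ} {s t : ℝ} (hs : 0 < s) (ht : 0 < t)
    {A : Set (Fin m → ℝ)} {B : Set Y} (hA : μH[s] A ≠ 0) (hB : μH[t] B ≠ 0) :
    μH[s + t] (A ×ˢ B) ≠ 0 := by
  classical
  intro hAB
  obtain ⟨b₀, hb₀, hB₀⟩ : ∃ b : ℝ≥0∞, 0 < b ∧ ¬ HasScaleCover t b B := by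
    by_contra! h
    exact hB (hausdorffMeasure_eq_zero_of_hasScaleCover ht fun ε hε _ => h ε hε)
  obtain ⟨b, hb, hbt, hBb⟩ : ∃ b : ℝ≥0∞, 0 < b ∧ b ≠ ⊤ ∧ ¬ HasScaleCover t b B :=
    ⟨min b₀ 1, lt_min hb₀ one_pos, (min_lt_of_right_lt ENNReal.one_lt_top).ne,
      fun h => hB₀ (h.mono (min_le_left _ _))⟩
  refine hA (hausdorffMeasure_eq_zero_of_hasScaleCover hs fun ε hε hεt => ?_)
  -- a set of diameter at most `2⁻ⁿ` meets at most `N = 3ᵐ` dyadic cubes of side `2⁻ⁿ`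
  set N : ℝ≥0∞ := (Fintype.card (Fin m → Fin 3) : ℝ≥0∞) with hN
  have hN0 : N ≠ 0 := by simp [hN]
  have hNt : N ≠ ⊤ := ENNReal.natCast_ne_top _
  obtain ⟨ι, hι, U, n, hcov, hdiam, hsum⟩ := hasScaleCover_of_hausdorffMeasure_eq_zero
    (add_pos hs ht) hAB (ε := ε * b / N) (ENNReal.div_pos (mul_ne_zero hε.ne' hb.ne') hNt)
  have hp : ∀ i, ∃ p : Fin m → ℝ, ∀ u ∈ U i, edist u.1 p ≤ 2⁻¹ ^ n i := by
    intro i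
    rcases (U i).eq_empty_or_nonempty with he | ⟨u₀, hu₀⟩
    · exact ⟨0, by simp [he]⟩
    · refine ⟨u₀.1, fun u hu => ?_⟩
      exact (le_max_left _ _).trans ((Metric.edist_le_ediam_of_mem hu hu₀).trans (hdiam i))
  choose p hp using hp
  set c : ℕ → ℝ≥0∞ := fun n => (2⁻¹ ^ n) ^ t / b with hc
  obtain ⟨T, hT1, hT3⟩ := exists_cells_cover_of_indexed_weighted_cover
    (dyadicCell (m := m)) dyadicCell_nested (fun n => ((2⁻¹ : ℝ≥0∞) ^ n) ^ s)
    (fun j : ι × (Fin m → Fin 3) => n j.1)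
    (fun j i => dyadicCell (n j.1) (p j.1) i + ((j.2 i : ℕ) : ℤ) - 1)
    (fun j => c (n j.1)) A (by
      intro x hx
      set J : Set ι := {i | ∃ y, (x, y) ∈ U i} with hJ
      have hslice : b ≤ ∑' i : J, ((2⁻¹ : ℝ≥0∞) ^ n i) ^ t := by
        by_contra! hlt
        refine hBb ⟨J, inferInstance, fun i => {y | (x, y) ∈ U i}, fun i => n i, ?_, ?_, hlt.le⟩
        · intro y hy
          obtain ⟨i, hi⟩ := mem_iUnion.1 (hcov (mk_mem_prod hx hy))
          exact mem_iUnion.2 ⟨⟨i, y, hi⟩, hi⟩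
        · intro i
          refine Metric.ediam_le fun y hy y' hy' => ?_
          calc edist y y' ≤ edist (x, y) (x, y') := le_max_right _ _
            _ ≤ 2⁻¹ ^ n i := (Metric.edist_le_ediam_of_mem (s := U i) hy hy').trans (hdiam i)
      have hcell : ∀ i : J, ∃ e : Fin m → Fin 3, dyadicCell (n i) x =
          fun l => dyadicCell (n i) (p i) l + ((e l : ℕ) : ℤ) - 1 := by
        rintro ⟨i, y, hy⟩
        exact exists_dyadicCell_eq_add _ _ _ (hp i _ hy)
      choose e he using hcell
      have h1 : 1 ≤ ∑' i : J, c (n i) := by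
        simp only [hc, div_eq_mul_inv]
        rw [ENNReal.tsum_mul_right, ← div_eq_mul_inv, ENNReal.le_div_iff_mul_le (Or.inl hb.ne')
          (Or.inl hbt), one_mul]
        exact hslice
      refine h1.trans ?_
      have hinj : Function.Injective
          (fun i : J => (⟨(i.1, e i), he i⟩ : {j : ι × (Fin m → Fin 3) // dyadicCell (n j.1) x =
            fun l => dyadicCell (n j.1) (p j.1) l + ((j.2 l : ℕ) : ℤ) - 1})) := by
        intro i i' h
        exact Subtype.ext (congrArg (fun j => j.1.1) h)
      exact ENNReal.tsum_comp_le_tsum_of_injective hinj fun j => c (n j.1.1))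
  refine ⟨T, inferInstance, fun j => {x | dyadicCell j.1.1 x = j.1.2}, fun j => j.1.1, ?_, ?_, ?_⟩
  · intro x hx
    obtain ⟨k, hk⟩ := hT1 x hx
    exact mem_iUnion.2 ⟨⟨_, hk⟩, rfl⟩
  · intro j
    exact ediam_dyadicCell_le _ _
  · refine hT3.trans ?_
    rw [ENNReal.tsum_prod']
    simp only [tsum_fintype, Finset.sum_const, Finset.card_univ, nsmul_eq_mul]
    rw [ENNReal.tsum_mul_left, ← hN]
    have : ∀ i, c (n i) * ((2⁻¹ : ℝ≥0∞) ^ n i) ^ s = b⁻¹ * (2⁻¹ ^ n i) ^ (s + t) := by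
      intro i
      rw [rpow_add_dyadic, hc]
      simp only [div_eq_mul_inv]
      ring
    simp only [this]
    rw [ENNReal.tsum_mul_left]
    calc N * (b⁻¹ * ∑' i, ((2⁻¹ : ℝ≥0∞) ^ n i) ^ (s + t)) ≤ N * (b⁻¹ * (ε * b / N)) := by gcongr
      _ = (N * N⁻¹) * (b⁻¹ * b) * ε := by rw [div_eq_mul_inv]; ring
      _ = ε := by
        rw [ENNReal.mul_inv_cancel hN0 hNt, ENNReal.inv_mul_cancel hb.ne' hbt, one_mul, one_mul]

/-- The product of a set with `ℝᵐ` has dimension larger by at most `m`, as the unit cube is a union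
of `2ⁿᵐ` cubes of side `2⁻ⁿ`. -/
theorem hausdorffMeasure_prod_univ_eq_zero (m : ℕ) {u : ℝ} (hu : 0 < u) {B : Set Y}
    (hB : μH[u] B = 0) : μH[m + u] (B ×ˢ (univ : Set (Fin m → ℝ))) = 0 := by
  have hunion : B ×ˢ (univ : Set (Fin m → ℝ)) =
      ⋃ z : Fin m → ℤ, B ×ˢ {x : Fin m → ℝ | dyadicCell 0 x = z} := by
    ext ⟨y, x⟩; simp
  rw [hunion]
  refine measure_iUnion_null fun z => ?_
  refine hausdorffMeasure_eq_zero_of_hasScaleCover (by positivity) fun ε hε hεt => ?_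
  obtain ⟨ι, hι, U, n, hcov, hdiam, hsum⟩ := hasScaleCover_of_hausdorffMeasure_eq_zero hu hB hε
  refine ⟨Σ i : ι, (Fin m → Fin (2 ^ n i)), inferInstance, fun j => U j.1 ×ˢ
    {x | dyadicCell (n j.1) x = fun l => 2 ^ n j.1 * z l + ((j.2 l : ℕ) : ℤ)},
    fun j => n j.1, ?_, ?_, ?_⟩
  · rintro ⟨y, x⟩ ⟨hy, hx⟩
    obtain ⟨i, hi⟩ := mem_iUnion.1 (hcov hy)
    have hcell : ∀ l, ∃ e : Fin (2 ^ n i),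
        dyadicCell (n i) x l = 2 ^ n i * z l + ((e : ℕ) : ℤ) := by
      intro l
      have hl : ⌊2 ^ 0 * x l⌋ = z l := congrFun hx l
      rw [pow_zero, one_mul, Int.floor_eq_iff] at hl
      have l1 : 2 ^ n i * z l ≤ ⌊2 ^ n i * x l⌋ := by
        rw [Int.le_floor]; push_cast; gcongr; exact hl.1
      have l2 : ⌊2 ^ n i * x l⌋ < 2 ^ n i * z l + 2 ^ n i := by
        rw [Int.floor_lt]; push_cast
        calc (2 : ℝ) ^ n i * x l < 2 ^ n i * (z l + 1) := by gcongr; exact hl.2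
          _ = _ := by ring
      refine ⟨⟨(⌊2 ^ n i * x l⌋ - 2 ^ n i * z l).toNat, ?_⟩, ?_⟩
      · zify
        rw [Int.toNat_of_nonneg (by omega)]
        linarith
      · simp only [dyadicCell]
        rw [Int.toNat_of_nonneg (by omega)]
        ring
    choose e he using hcell
    exact mem_iUnion.2 ⟨⟨i, e⟩, hi, funext he⟩
  · rintro ⟨i, e⟩
    refine Metric.ediam_le fun a ha b hb => ?_
    exact max_le ((Metric.edist_le_ediam_of_mem ha.1 hb.1).trans (hdiam i))
      ((Metric.edist_le_ediam_of_mem ha.2 hb.2).trans (ediam_dyadicCell_le _ _))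
  · rw [ENNReal.tsum_sigma']
    simp only [tsum_fintype, Finset.sum_const, Finset.card_univ, nsmul_eq_mul]
    refine le_trans (ENNReal.tsum_le_tsum fun i => le_of_eq ?_) hsum
    rw [rpow_add_dyadic, ENNReal.rpow_natCast, ← mul_assoc]
    simp only [Fintype.card_fun, Fintype.card_fin, Nat.cast_pow, Nat.cast_ofNat]
    rw [← mul_pow, ← mul_pow, ENNReal.mul_inv_cancel (by simp) (by simp), one_pow, one_pow,
      one_mul]

end Product

theorem dimH_add_le_dimH_prod_pi {Y : Type*} [EMetricSpace Y] {m : ℕ} {A : Set (Fin m → ℝ)}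
    {B : Set Y} (hA : A.Nonempty) (hB : B.Nonempty) : dimH A + dimH B ≤ dimH (A ×ˢ B) := by
  obtain ⟨a, ha⟩ := hA
  obtain ⟨y, hy⟩ := hB
  rcases eq_or_ne (dimH A) 0 with hA0 | hA0
  · have hiso : Isometry (fun y : Y => (a, y)) := fun y y' => by simp [Prod.edist_eq]
    rw [hA0, zero_add, ← hiso.dimH_image B]
    exact dimH_mono (by rintro _ ⟨y, hy, rfl⟩; exact ⟨ha, hy⟩)
  rcases eq_or_ne (dimH B) 0 with hB0 | hB0
  · have hiso : Isometry (fun x : Fin m → ℝ => (x, y)) := fun y y' => by simp [Prod.edist_eq]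
    rw [hB0, add_zero, ← hiso.dimH_image A]
    exact dimH_mono (by rintro _ ⟨x, hx, rfl⟩; exact ⟨hx, hy⟩)
  refine le_of_forall_lt fun r hr => ?_
  obtain ⟨s', hs', t', ht', hr'⟩ := ENNReal.exists_lt_add_of_lt_add hr hA0 hB0
  obtain ⟨s, hs, hsA⟩ := ENNReal.lt_iff_exists_nnreal_btwn.1 hs'
  obtain ⟨t, ht, htB⟩ := ENNReal.lt_iff_exists_nnreal_btwn.1 ht'
  have hs0 : 0 < s := by exact_mod_cast zero_le.trans_lt hs
  have ht0 : 0 < t := by exact_mod_cast zero_le.trans_lt ht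
  borelize Y
  have h := hausdorffMeasure_prod_ne_zero (s := s) (t := t) hs0 ht0
    (by rw [hausdorffMeasure_of_lt_dimH hsA]; simp) (by rw [hausdorffMeasure_of_lt_dimH htB]; simp)
  rw [← NNReal.coe_add] at h
  refine (hr'.trans (ENNReal.add_lt_add hs ht)).trans_le ?_
  exact_mod_cast le_dimH_of_hausdorffMeasure_ne_zero h

theorem dimH_prod_univ_le {Y : Type*} [EMetricSpace Y] (m : ℕ) (B : Set Y) :
    dimH (B ×ˢ (univ : Set (Fin m → ℝ))) ≤ dimH B + m := by
  refine ENNReal.le_of_forall_pos_le_add fun ε hε hfin => ?_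
  have hBfin : dimH B ≠ ⊤ := (le_self_add.trans_lt hfin).ne
  obtain ⟨u, hu, huε⟩ := ENNReal.lt_iff_exists_nnreal_btwn.1
    (ENNReal.lt_add_right hBfin (by exact_mod_cast hε.ne' : (ε : ℝ≥0∞) ≠ 0))
  have hu0 : 0 < u := by exact_mod_cast zero_le.trans_lt hu
  borelize Y
  have h := hausdorffMeasure_prod_univ_eq_zero m (u := u) hu0 (hausdorffMeasure_of_dimH_lt hu)
  have h' : μH[((m + u : NNReal) : ℝ)] (B ×ˢ (univ : Set (Fin m → ℝ))) ≠ ⊤ := by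
    push_cast; rw [h]; simp
  refine (dimH_le_of_hausdorffMeasure_ne_top h').trans ?_
  push_cast
  rw [add_right_comm, add_comm (m : ℝ≥0∞)]
  gcongr

/-! ### Powers of a set and degenerate tuples -/

theorem dimH_add_dimH_power_le {d : ℕ} (k : ℕ) {F : Set (Euc d)} (hF : F.Nonempty) :
    dimH F + dimH (power k F) ≤ dimH (power (k + 1) F) := by
  have hne : (power k F).Nonempty := by
    obtain ⟨p, hp⟩ := hF
    exact ⟨WithLp.toLp 2 fun _ => p, fun _ => hp⟩
  rw [← (EuclideanSpace.equiv (Fin d) ℝ).dimH_image F]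
  refine (dimH_add_le_dimH_prod_pi (hF.image _) hne).trans ?_
  set g : Tuples d (k + 1) → (Fin d → ℝ) × Tuples d k := fun x =>
    (EuclideanSpace.equiv (Fin d) ℝ (x 0), WithLp.toLp 2 fun i => x i.succ) with hg
  have hgd : ContDiff ℝ 1 g := by
    refine ContDiff.prodMk ?_ ((contDiff_piLp 2).2 fun i => ?_) <;> fun_prop
  refine le_trans (dimH_mono ?_)
    (hgd.contDiffOn.dimH_image_le convex_univ (subset_univ (power (k + 1) F)))
  rintro ⟨_, y⟩ ⟨⟨p, hp, rfl⟩, hy⟩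
  refine ⟨WithLp.toLp 2 (Fin.cons p fun i => y i), fun i => ?_, rfl⟩
  refine Fin.cases hp (fun i => hy i) i

theorem mul_dimH_le_dimH_power {d : ℕ} (k : ℕ) {F : Set (Euc d)} (hF : F.Nonempty) :
    ((k : ℝ≥0∞) + 1) * dimH F ≤ dimH (power k F) := by
  induction k with
  | zero =>
    have hgd : ContDiff ℝ 1 fun x : Tuples d 0 => x 0 := by fun_prop
    simp only [Nat.cast_zero, zero_add, one_mul]
    refine le_trans (dimH_mono ?_)
      (hgd.contDiffOn.dimH_image_le convex_univ (subset_univ (power 0 F)))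
    exact fun p hp => ⟨WithLp.toLp 2 fun _ => p, fun _ => hp, rfl⟩
  | succ k ih =>
    refine le_trans ?_ (dimH_add_dimH_power_le k hF)
    push_cast
    rw [add_mul, one_mul, add_comm]
    gcongr

/-- In a degenerate tuple some point is a linear combination of the others, so the degenerate tuples
lie in finitely many smooth images of `F ^ (k + 1) × ℝ ^ (k + 1)`. -/
theorem dimH_degenerate_le {d : ℕ} (k : ℕ) (F : Set (Euc d)) :
    dimH (degenerate (k + 1) F) ≤ dimH (power k F) + ((k + 1 : ℕ) : ℝ≥0∞) := by
  set G : Fin (k + 2) → Tuples d k × (Fin (k + 1) → ℝ) → Tuples d (k + 1) := fun i yl =>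
    WithLp.toLp 2 (i.insertNth (∑ j, yl.2 j • yl.1 j) fun j => yl.1 j) with hG
  have hGd : ∀ i, ContDiff ℝ 1 (G i) := by
    intro i
    refine (contDiff_piLp 2).2 fun j => ?_
    refine Fin.succAboveCases i ?_ (fun j => ?_) j
    · simp only [hG, Fin.insertNth_apply_same]
      fun_prop
    · simp only [hG, Fin.insertNth_apply_succAbove]
      fun_prop
  have hsub : degenerate (k + 1) F ⊆ ⋃ i, G i '' (power k F ×ˢ univ) := by
    rintro x ⟨hx, hdep⟩
    rw [affineIndependent_iff] at hdep
    push Not at hdep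
    obtain ⟨s, w, -, hw, i, hi, hwi⟩ := hdep
    classical
    have hw' : ∑ e, (if e ∈ s then w e else 0) • x e = 0 := by
      rw [← hw]; simp [ite_smul, Finset.sum_ite_mem]
    rw [Fin.sum_univ_succAbove _ i, if_pos hi] at hw'
    refine mem_iUnion.2 ⟨i, (WithLp.toLp 2 fun j => x (i.succAbove j),
      fun j => -(w i)⁻¹ * (if i.succAbove j ∈ s then w (i.succAbove j) else 0)),
      ⟨fun j => hx _, mem_univ _⟩, ?_⟩
    refine PiLp.ext fun j => ?_
    refine Fin.succAboveCases i ?_ (fun j => ?_) j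
    · simp only [hG, Fin.insertNth_apply_same]
      simp_rw [mul_smul]
      rw [← Finset.smul_sum, eq_neg_of_add_eq_zero_right hw', smul_neg, neg_smul, neg_neg, smul_smul,
        inv_mul_cancel₀ hwi, one_smul]
    · simp only [hG, Fin.insertNth_apply_succAbove]
  refine (dimH_mono hsub).trans ?_
  rw [dimH_iUnion]
  exact iSup_le fun i => ((hGd i).contDiffOn.dimH_image_le convex_univ (subset_univ _)).trans
    (dimH_prod_univ_le _ _)

theorem dimH_power_diff_degenerate {d k : ℕ} (hk : 1 ≤ k) {F : Set (Euc d)}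
    (hF : (k : ℝ≥0∞) < dimH F) : dimH (power k F \ degenerate k F) = dimH (power k F) := by
  obtain ⟨k, rfl⟩ := Nat.exists_eq_add_of_le' hk
  have hne : F.Nonempty := by
    rw [nonempty_iff_ne_empty]
    rintro rfl
    simp at hF
  have hlt : dimH (degenerate (k + 1) F) < dimH (power (k + 1) F) := by
    calc dimH (degenerate (k + 1) F) ≤ dimH (power k F) + ((k + 1 : ℕ) : ℝ≥0∞) :=
          dimH_degenerate_le k F
      _ < dimH (power k F) + dimH F :=
          ENNReal.add_lt_add_left (Real.dimH_ne_top _) hF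
      _ ≤ dimH (power (k + 1) F) := by
          rw [add_comm]; exact dimH_add_dimH_power_le k hne
  refine le_antisymm (dimH_mono sdiff_subset) ?_
  have h := dimH_union (power (k + 1) F \ degenerate (k + 1) F) (degenerate (k + 1) F)
  rw [sdiff_union_of_subset (fun x hx => hx.1)] at h
  rw [h]
  refine max_le le_rfl (le_of_not_gt fun hgt => ?_)
  rw [max_eq_right hgt.le] at h
  exact hlt.ne' h

/-! ### The diagonal embedding of the affine Grassmannian -/

section PowerPlane

variable {d : ℕ}

theorem dist_affinePlane_eq {H : Type*} [NormedAddCommGroup H] [InnerProductSpace ℝ H]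
    [FiniteDimensional ℝ H] (W V : AffinePlane H) : dist W V = dist W.coords V.coords := rfl

theorem mem_direction_powerPlane (k : ℕ) (W : AffinePlane (Euc d)) (v : Tuples d k) :
    v ∈ (powerPlane k W).1.direction ↔ ∀ i, v i ∈ W.1.direction := by
  obtain ⟨p, hp⟩ := W.2
  have hp' : (WithLp.toLp 2 fun _ => p : Tuples d k) ∈ (powerPlane k W).1 := fun _ => hp
  rw [← AffineSubspace.vadd_mem_iff_mem_direction _ hp']
  exact forall_congr' fun i => AffineSubspace.vadd_mem_iff_mem_direction (v i) hp

theorem proj_powerPlane_apply (k : ℕ) (W : AffinePlane (Euc d)) (v : Tuples d k) (i : Fin (k + 1)) :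
    (powerPlane k W).proj v i = W.proj (v i) := by
  have : (powerPlane k W).proj v = WithLp.toLp 2 fun i => W.proj (v i) := by
    refine Submodule.eq_starProjection_of_mem_of_inner_eq_zero
      ((mem_direction_powerPlane k W _).2 fun i => Submodule.starProjection_apply_mem _ _)
      fun w hw => ?_
    rw [PiLp.inner_apply]
    refine Finset.sum_eq_zero fun i _ => ?_
    exact Submodule.starProjection_inner_eq_zero _ _ ((mem_direction_powerPlane k W w).1 hw i)
  rw [this]

theorem foot_powerPlane_apply (k : ℕ) (W : AffinePlane (Euc d)) (i : Fin (k + 1)) :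
    (powerPlane k W).foot i = W.foot := by
  have hW : Nonempty W.1 := W.2.to_subtype
  have hP : Nonempty (powerPlane k W).1 := (powerPlane k W).2.to_subtype
  have hmem := (EuclideanGeometry.coe_orthogonalProjection_eq_iff_mem (s := W.1)
    (p := (0 : Euc d)) (q := W.foot)).1 rfl
  have : (powerPlane k W).foot = WithLp.toLp 2 fun _ => W.foot := by
    refine EuclideanGeometry.coe_orthogonalProjection_eq_iff_mem.2 ⟨fun _ => hmem.1, ?_⟩
    rw [Submodule.mem_orthogonal]
    intro u hu
    rw [PiLp.inner_apply]
    refine Finset.sum_eq_zero fun i _ => ?_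
    exact (Submodule.mem_orthogonal _ _).1 hmem.2 _ ((mem_direction_powerPlane k W u).1 hu i)
  rw [this]

/-- The componentwise action `(v₀, …, v_k) ↦ (T v₀, …, T v_k)` of an operator on tuples. -/
noncomputable def componentwise (k : ℕ) (T : Euc d →L[ℝ] Euc d) : Tuples d k →L[ℝ] Tuples d k :=
  (PiLp.continuousLinearEquiv 2 ℝ fun _ : Fin (k + 1) => Euc d).symm.toContinuousLinearMap ∘L
    ContinuousLinearMap.pi fun i => T ∘L PiLp.proj 2 (fun _ : Fin (k + 1) => Euc d) i

theorem componentwise_apply (k : ℕ) (T : Euc d →L[ℝ] Euc d) (v : Tuples d k) (i : Fin (k + 1)) :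
    componentwise k T v i = T (v i) := rfl

/-- The effect of `W ↦ W ^ (k + 1)` on the coordinates (projection, foot point): it is the
restriction of the injective linear map `(T, a) ↦ (T × ⋯ × T, (a, …, a))`. -/
noncomputable def powerPlaneCoords (d k : ℕ) :
    ((Euc d →L[ℝ] Euc d) × Euc d) →ₗ[ℝ] ((Tuples d k →L[ℝ] Tuples d k) × Tuples d k) where
  toFun p := (componentwise k p.1, WithLp.toLp 2 fun _ => p.2)
  map_add' p q := by
    refine Prod.ext (ContinuousLinearMap.ext fun v => PiLp.ext fun i => ?_) rfl
    simp [componentwise_apply]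
  map_smul' c p := by
    refine Prod.ext (ContinuousLinearMap.ext fun v => PiLp.ext fun i => ?_) rfl
    simp [componentwise_apply]

theorem powerPlaneCoords_injective (d k : ℕ) : Function.Injective (powerPlaneCoords d k) := by
  rintro ⟨T, a⟩ ⟨S, b⟩ h
  obtain ⟨h1, h2⟩ := Prod.ext_iff.1 h
  refine Prod.ext (ContinuousLinearMap.ext fun v => ?_) ?_
  · exact congrArg (fun R : Tuples d k →L[ℝ] Tuples d k => R (WithLp.toLp 2 fun _ => v) 0) h1
  · exact congrArg (fun x : Tuples d k => x 0) h2

theorem coords_powerPlane (k : ℕ) (W : AffinePlane (Euc d)) :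
    (powerPlane k W).coords = powerPlaneCoords d k W.coords := by
  refine Prod.ext ?_ (PiLp.ext fun i => foot_powerPlane_apply k W i)
  exact ContinuousLinearMap.ext fun v => PiLp.ext fun i => proj_powerPlane_apply k W v i

theorem exists_lipschitzWith_of_finiteDimensional {V W : Type*} [NormedAddCommGroup V]
    [NormedSpace ℝ V] [FiniteDimensional ℝ V] [NormedAddCommGroup W] [NormedSpace ℝ W]
    (L : V →ₗ[ℝ] W) : ∃ K, LipschitzWith K L :=
  ⟨_, (LinearMap.toContinuousLinearMap L).lipschitz⟩

theorem exists_lipschitzWith_powerPlane (d k : ℕ) :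
    ∃ K, LipschitzWith K (powerPlane k : AffinePlane (Euc d) → AffinePlane (Tuples d k)) := by
  obtain ⟨K, hL⟩ := exists_lipschitzWith_of_finiteDimensional (powerPlaneCoords d k)
  refine ⟨K, LipschitzWith.of_dist_le_mul fun W V => ?_⟩
  rw [dist_affinePlane_eq, coords_powerPlane, coords_powerPlane]
  exact hL.dist_le_mul _ _

theorem exists_antilipschitzWith_powerPlane (d k : ℕ) :
    ∃ K, AntilipschitzWith K (powerPlane k : AffinePlane (Euc d) → AffinePlane (Tuples d k)) := by
  obtain ⟨K, -, hK⟩ := LinearMap.exists_antilipschitzWith (powerPlaneCoords d k)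
    (LinearMap.ker_eq_bot.2 (powerPlaneCoords_injective d k))
  refine ⟨K, AntilipschitzWith.of_le_mul_dist fun W V => ?_⟩
  rw [dist_affinePlane_eq, dist_affinePlane_eq, coords_powerPlane, coords_powerPlane]
  exact hK.le_mul_dist _ _

end PowerPlane

theorem dimH_carrier_le {d : ℕ} (V : AffinePlane (Euc d)) : dimH V.carrier ≤ V.dim := by
  obtain ⟨p, hp⟩ := V.2
  have hiso : Isometry fun v : V.1.direction => (v : Euc d) + p :=
    (isometry_add_right p).comp isometry_subtype_coe
  refine le_trans (dimH_mono (t := range fun v : V.1.direction => (v : Euc d) + p) ?_) ?_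
  · exact fun x hx => ⟨⟨x - p, AffineSubspace.vsub_mem_direction hx hp⟩, sub_add_cancel _ _⟩
  · rw [← image_univ, hiso.dimH_image, Real.dimH_univ_eq_finrank]
    rfl

/-! ### Comparing essential suprema -/

section EssSup

variable {X Y : Type*} [EMetricSpace X] [MeasurableSpace X] [BorelSpace X]
  [EMetricSpace Y] [MeasurableSpace Y] [BorelSpace Y]

theorem hausdorffMeasure_image_ne_zero {g : X → Y} {K : NNReal} (hg : AntilipschitzWith K g)
    {α : ℝ} (hα : 0 ≤ α) {P : Set X} (hP : 0 < μH[α] P) : 0 < μH[α] (g '' P) := by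
  refine pos_iff_ne_zero.2 fun h => ?_
  have := hg.le_hausdorffMeasure_image hα P
  rw [h, mul_zero] at this
  exact hP.not_ge this

theorem essSupPos_le_of_antilipschitzWith {g : X → Y} {K : NNReal} (hg : AntilipschitzWith K g)
    {α : ℝ} (hα : 0 ≤ α) {P : Set X} {f₁ : X → ℝ≥0∞} {f₂ : Y → ℝ≥0∞}
    (hf : ∀ x ∈ P, f₁ x ≤ f₂ (g x)) : essSupPos α P f₁ ≤ essSupPos α (g '' P) f₂ := by
  refine sSup_le_sSup fun q hq => ?_
  refine (hausdorffMeasure_image_ne_zero hg hα hq).trans_le (measure_mono ?_)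
  rintro _ ⟨x, ⟨hx, hqx⟩, rfl⟩
  exact ⟨mem_image_of_mem g hx, hqx.trans_le (hf x hx)⟩

/-- Both Lipschitz bounds are needed: the lower one transports sets of positive measure, the upper
one ensures that the two essential suprema are computed by the same case of the definition. -/
theorem hausdorffEssSup_le_of_bilipschitz {g : X → Y} {K K' : NNReal} (hg : LipschitzWith K g)
    (hg' : AntilipschitzWith K' g) {α : ℝ} (hα : 0 ≤ α) {P : Set X} (hP : P.Nonempty)
    {f₁ : X → ℝ≥0∞} {f₂ : Y → ℝ≥0∞} (hf : ∀ x ∈ P, f₁ x ≤ f₂ (g x)) :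
    hausdorffEssSup α P f₁ ≤ hausdorffEssSup α (g '' P) f₂ := by
  unfold hausdorffEssSup
  by_cases h : 0 < μH[α] P
  · rw [if_pos h, if_pos (hausdorffMeasure_image_ne_zero hg' hα h)]
    exact essSupPos_le_of_antilipschitzWith hg' hα hf
  · have h0 : μH[α] P = 0 := by simpa using h
    have h0' : ¬ 0 < μH[α] (g '' P) := by
      have := hg.hausdorffMeasure_image_le hα P
      rw [h0, mul_zero] at this
      exact this.not_gt
    rw [if_neg h, if_neg h0']
    -- `ℋ⁰` is the counting measure, so the exponents `α - ε` are eventually nonnegative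
    have hα' : 0 < α := by
      refine hα.lt_of_ne fun h1 => h ?_
      obtain ⟨x, hx⟩ := hP
      rw [← h1]
      refine lt_of_lt_of_le ?_ (measure_mono (singleton_subset_iff.2 hx))
      rw [Measure.hausdorffMeasure_zero_singleton]
      exact one_pos
    refine le_of_tendsto_of_tendsto (tendsto_essSupPos α P f₁) (tendsto_essSupPos α _ f₂) ?_
    filter_upwards [nhdsWithin_le_nhds (eventually_lt_nhds hα')] with ε hε
    exact essSupPos_le_of_antilipschitzWith hg' (sub_nonneg.2 hε.le) hf

end EssSup

/-! ### The dimension of the set of spanned planes -/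

section Spanned

variable {d k : ℕ}

theorem fst_image_incidenceSet (A : Set (Euc d)) :
    Prod.fst '' incidenceSet k A = spannedPlanes k A := by
  ext W
  constructor
  · rintro ⟨_, ⟨x, ⟨hx, hnd⟩, rfl⟩, rfl⟩
    exact ⟨x, hx, by_contra fun h => hnd ⟨hx, h⟩, rfl⟩
  · rintro ⟨x, hx, hind, rfl⟩
    exact ⟨_, ⟨x, ⟨hx, fun h => h.2 hind⟩, rfl⟩, rfl⟩

theorem dimH_power_diff_degenerate_le_incidenceSet (A : Set (Euc d)) :
    dimH (power k A \ degenerate k A) ≤ dimH (incidenceSet k A) := by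
  refine le_trans (dimH_mono ?_) (LipschitzWith.prod_snd.dimH_image_le (incidenceSet k A))
  exact fun x hx => ⟨_, mem_image_of_mem _ hx, rfl⟩

theorem dimH_fiber_incidenceSet_le (A : Set (Euc d)) (W : AffinePlane (Euc d)) :
    dimH (Prod.fst ⁻¹' {W} ∩ incidenceSet k A) ≤ dimH (power k A ∩ (powerPlane k W).carrier) := by
  have hiso : Isometry fun x : Tuples d k => (W, x) := fun x y => by simp [Prod.edist_eq]
  rw [← hiso.dimH_image]
  refine dimH_mono ?_
  rintro _ ⟨h, ⟨x, ⟨hx, -⟩, rfl⟩⟩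
  have h : spanPlane x = W := h
  subst h
  exact ⟨x, ⟨hx, fun i => subset_affineSpan ℝ _ (mem_range_self i)⟩, rfl⟩

/-- The incidence set fibres over the spanned planes, and its fibre over `W` is contained in a copy
of `A ^ (k + 1) ∩ W ^ (k + 1)`. -/
theorem dimH_power_diff_degenerate_le {A : Set (Euc d)}
    (hA : HasFubiniProperty (incidenceSet k A)) :
    dimH (power k A \ degenerate k A) ≤ dimH (spannedPlanes k A) +
      hausdorffEssSup (dimH (spannedPlanes k A)).toReal (diagonalPlanes k A)
        (fun U => dimH (power k A ∩ U.carrier)) := by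
  obtain ⟨hne, hdim⟩ := hA
  rw [fst_image_incidenceSet] at hdim
  obtain ⟨K, hK⟩ := exists_lipschitzWith_powerPlane d k
  obtain ⟨K', hK'⟩ := exists_antilipschitzWith_powerPlane d k
  refine ((dimH_power_diff_degenerate_le_incidenceSet A).trans_eq hdim).trans ?_
  gcongr
  refine hausdorffEssSup_le_of_bilipschitz hK hK' ENNReal.toReal_nonneg ?_
    fun W _ => dimH_fiber_incidenceSet_le A W
  rw [← fst_image_incidenceSet]
  exact hne.image _

theorem dimH_inter_eq_of_captures {V : AffinePlane (Euc d)} {E : Set (Euc d)} (h : Captures V E) :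
    dimH (E ∩ V.carrier) = dimH E := by
  have hu := dimH_union (E ∩ V.carrier) (E \ V.carrier)
  rw [inter_union_sdiff] at hu
  refine le_antisymm (dimH_mono inter_subset_left) (le_of_not_gt fun hlt => ?_)
  exact (max_lt hlt h).ne hu.symm

end Spanned

/-! ### The effective dimension and the lower bound -/

theorem corollary1p11 (d k : ℕ) (s : ℝ) (E : Set (Euc d)) (hE : MeasurableSet E)
    (hk : (k : ℝ) < s) (hs : ENNReal.ofReal s < dimH E) :
    k + 1 ≤ effectiveDim E ∧ effectiveDim E ≤ d ∧
    (∃ V : AffinePlane (Euc d), V.dim = effectiveDim E ∧ Captures V E) ∧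
    ∀ V : AffinePlane (Euc d), V.dim = effectiveDim E → Captures V E →
      ∀ F : Set (Euc d), F = E ∩ V.carrier →
      HasFubiniProperty (incidenceSet k F) →
      hausdorffEssSup (dimH (spannedPlanes k F)).toReal (diagonalPlanes k F)
          (fun U => dimH (power k F ∩ U.carrier)) ≤
        max 0 (dimH (power k F) - ((k : ℝ≥0∞) + 1) * ((effectiveDim E : ℝ≥0∞) - k)) →
      1 ≤ k → k ≤ effectiveDim E - 1 →
        dimH (spannedPlanes k F) ≤ dimH (spannedPlanes k E) ∧
        ((k : ℝ≥0∞) + 1) * min (ENNReal.ofReal s) ((effectiveDim E : ℝ≥0∞) - k) ≤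
          dimH (spannedPlanes k F) := by
  have hkE : (k : ℝ≥0∞) < dimH E := by
    refine lt_of_le_of_lt ?_ hs
    rw [← ENNReal.ofReal_natCast]
    exact ENNReal.ofReal_le_ofReal hk.le
  have hcap : ∀ V : AffinePlane (Euc d), Captures V E → k + 1 ≤ V.dim := by
    intro V hV
    have h := (dimH_inter_eq_of_captures hV).ge.trans
      ((dimH_mono inter_subset_right).trans (dimH_carrier_le V))
    exact_mod_cast hkE.trans_le h
  have hmem : d ∈ {m : ℕ | ∃ V : AffinePlane (Euc d), V.dim = m ∧ Captures V E} := by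
    refine ⟨⟨⊤, univ_nonempty⟩, ?_, ?_⟩
    · change Module.finrank ℝ (⊤ : AffineSubspace ℝ (Euc d)).direction = d
      rw [AffineSubspace.direction_top, finrank_top, finrank_euclideanSpace_fin]
    · simpa [Captures, AffinePlane.carrier] using zero_le.trans_lt hkE
  obtain ⟨V₀, hV₀, hV₀E⟩ := Nat.sInf_mem ⟨d, hmem⟩
  refine ⟨(hcap V₀ hV₀E).trans_eq hV₀, Nat.sInf_le hmem, ⟨V₀, hV₀, hV₀E⟩, ?_⟩
  rintro V - hVE F rfl hFubini hess hk1 -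
  set F := E ∩ V.carrier with hF
  have hdimF : dimH F = dimH E := dimH_inter_eq_of_captures hVE
  have hne : F.Nonempty := by
    rw [nonempty_iff_ne_empty]
    intro h
    rw [← hdimF, h] at hkE
    simp at hkE
  refine ⟨dimH_mono ?_, ?_⟩
  · rintro W ⟨x, hx, hW⟩
    exact ⟨x, fun i => (hx i).1, hW⟩
  · set M : ℝ≥0∞ := (effectiveDim E : ℝ≥0∞) - k
    have hmain : dimH (power k F) ≤
        dimH (spannedPlanes k F) + (dimH (power k F) - ((k : ℝ≥0∞) + 1) * M) := by
      rw [max_eq_right zero_le] at hess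
      calc dimH (power k F) = dimH (power k F \ degenerate k F) :=
            (dimH_power_diff_degenerate hk1 (hdimF ▸ hkE)).symm
        _ ≤ _ := (dimH_power_diff_degenerate_le hFubini).trans (add_le_add_right hess _)
    have hlow : ((k : ℝ≥0∞) + 1) * ENNReal.ofReal s ≤ dimH (power k F) :=
      le_trans (by gcongr; exact hdimF ▸ hs.le) (mul_dimH_le_dimH_power k hne)
    -- where the excess of `dim F ^ (k + 1)` over `(k + 1) M` is positive, it cancels in `hmain`
    rcases le_total (dimH (power k F)) (((k : ℝ≥0∞) + 1) * M) with hle | hle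
    · rw [tsub_eq_zero_of_le hle, add_zero] at hmain
      exact le_trans (by gcongr; exact min_le_left _ _) (hlow.trans hmain)
    · have hfin : dimH (power k F) ≠ ⊤ := Real.dimH_ne_top _
      refine le_trans (b := ((k : ℝ≥0∞) + 1) * M) (by gcongr; exact min_le_right _ _) ?_
      refine (ENNReal.add_le_add_iff_right (ENNReal.sub_ne_top hfin
        (b := ((k : ℝ≥0∞) + 1) * M))).1 ?_
      rwa [add_tsub_cancel_of_le hle]
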